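/- Let $(\mathbb{E},\circ,\bullet)$ be a Euclidean Jordan algebra of dimension $n$: a finite-dimensional real inner product space with a bilinear commutative product satisfying $x\circ((x\circ x)\circ y)=(x\circ x)\circ(x\circ y)$, with an identity element $e$, and with $(x\circ y)\bullet z=x\bullet(y\circ z)$. Let $r$ be its rank, i.e. the largest degree of the minimal polynomial of an element. Let $\mathbb{E}_+=\{x\circ x\mid x\in\mathbb{E}\}$ be its symmetric cone, and let $\mathfrak{F}(\mathbb{E})\subseteq\mathbb{E}^r$ be the set of ordered Jordan frames $(c_1,\dots,c_r)$: each $c_i$ is a primitive idempotent (a nonzero idempotent that is not a sum of two nonzero idempotents), $c_i\circ c_j=0$ for $i\ne j$, and $\sum_i c_i=e$. For a real inner product space $\mathbb{V}$ of dimension $d$ and an integer $m\ge 0$, let $\mathcal{S}^{d,m}(\mathbb{V})\subseteq\mathbb{V}^{\otimes m}$ be the space of symmetric tensors, let $\langle\cdot,\cdot\rangle$ be the induced inner product on $\mathbb{V}^{\otimes m}$, and for $\mathbb{K}\subseteq\mathbb{V}$ let $$\mathcal{COP}^{d,m}(\mathbb{K})=\{\mathcal{A}\in\mathcal{S}^{d,m}(\mathbb{V})\mid\langle\mathcal{A},x^{\otimes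 m}\rangle\ge0\ \text{for all}\ x\in\mathbb{K}\}.$$ Write $\mathcal{S}^{r,m}=\mathcal{S}^{r,m}(\mathbb{R}^r)$ and $\mathcal{COP}^{r,m}=\mathcal{COP}^{r,m}(\mathbb{R}^r_+)$. For $\mathcal{A}\in\mathcal{S}^{n,m}(\mathbb{E})$ and $(c_1,\dots,c_r)\in\mathfrak{F}(\mathbb{E})$, let $\mathcal{A}(c_1,\dots,c_r)\in\mathcal{S}^{r,m}$ be the symmetric tensor with $(i_1,\dots,i_m)$-th element $\langle\mathcal{A},c_{i_1}\otimes\cdots\otimes c_{i_m}\rangle$. A set $\mathcal{K}\subseteq\mathcal{S}^{r,m}$ is permutation-invariant if $\mathscr{P}_\sigma\mathcal{K}=\mathcal{K}$ for every permutation $\sigma$ of $\{1,\dots,r\}$, where $(\mathscr{P}_\sigma\mathcal{A})_{i_1\cdots i_m}=\mathcal{A}_{\sigma(i_1)\cdots\sigma(i_m)}$. The symmetric group $\mathfrak{S}_r$ acts on $\mathfrak{F}(\mathbb{E})$ by permuting the members of a frame. Call $\mathfrak{F}\subseteq\mathfrak{F}(\mathbb{E})$ admissible if it contains a complete set of representatives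 of the orbits of this action (a set of ordered Jordan frames that has exactly one element in each orbit). Then: 1. $\displaystyle\mathcal{COP}^{n,m}(\mathbb{E}_+)=\bigcap_{(c_1,\dots,c_r)\in\mathfrak{F}(\mathbb{E})}\{\mathcal{A}\in\mathcal{S}^{n,m}(\mathbb{E})\mid\mathcal{A}(c_1,\dots,c_r)\in\mathcal{COP}^{r,m}\}.$ 2. For every permutation-invariant set $\mathcal{K}\subseteq\mathcal{S}^{r,m}$, the set $\displaystyle\bigcap_{(c_1,\dots,c_r)\in\mathfrak{F}}\{\mathcal{A}\in\mathcal{S}^{n,m}(\mathbb{E})\mid\mathcal{A}(c_1,\dots,c_r)\in\mathcal{K}\}$ is the same for all admissible $\mathfrak{F}$. 3. $\mathcal{COP}^{r,m}$ is permutation-invariant, and hence for every admissible $\mathfrak{F}$, $$\mathcal{COP}^{n,m}(\mathbb{E}_+)=\bigcap_{(c_1,\dots,c_r)\in\mathfrak{F}}\{\mathcal{A}\in\mathcal{S}^{n,m}(\mathbb{E})\mid\mathcal{A}(c_1,\dots,c_r)\in\mathcal{COP}^{r,m}\}.$$ -/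

import Mathlib

open scoped TensorProduct

noncomputable section

/-! ### Tensors on a real inner product space -/

section Tensors

variable {V : Type*} [NormedAddCommGroup V] [InnerProductSpace ℝ V] {m : ℕ}

/-- The linear map `π_σ` on `V^{⊗m}` with
`π_σ (v_1 ⊗ ⋯ ⊗ v_m) = v_{σ(1)} ⊗ ⋯ ⊗ v_{σ(m)}`. -/
def permTensor (σ : Equiv.Perm (Fin m)) : (⨂[ℝ]^m V) →ₗ[ℝ] (⨂[ℝ]^m V) :=
  PiTensorProduct.lift
    ((PiTensorProduct.tprod ℝ (s := fun _ : Fin m => V)).domDomCongr σ)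

@[simp] theorem permTensor_tprod (σ : Equiv.Perm (Fin m)) (v : Fin m → V) :
    permTensor σ (PiTensorProduct.tprod ℝ v) = PiTensorProduct.tprod ℝ (v ∘ σ) := by
  simp [permTensor, Function.comp_def]

variable (V m) in
/-- The space of symmetric tensors of order `m` over `V`, a subspace of `V^{⊗m}`. -/
def SymTensor : Submodule ℝ (⨂[ℝ]^m V) where
  carrier := {A | ∀ σ : Equiv.Perm (Fin m), permTensor σ A = A}
  add_mem' := fun ha hb σ => by rw [map_add, ha σ, hb σ]
  zero_mem' := fun σ => map_zero _
  smul_mem' := fun r a ha σ => by rw [map_smul, ha σ]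

variable (V m) in
/-- The inner product on `V^{⊗m}` induced by that of `V`, as a bilinear form; it is determined by
`⟨x_1 ⊗ ⋯ ⊗ x_m, y_1 ⊗ ⋯ ⊗ y_m⟩ = ∏ i, ⟨x_i, y_i⟩`, see `tensorInner_tprod`. -/
def tensorInner : (⨂[ℝ]^m V) →ₗ[ℝ] (⨂[ℝ]^m V) →ₗ[ℝ] ℝ :=
  TensorPower.pairingDual ℝ V m ∘ₗ
    PiTensorProduct.map (fun _ : Fin m => (innerₗ V : V →ₗ[ℝ] Module.Dual ℝ V))

@[simp] theorem tensorInner_tprod (x y : Fin m → V) :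
    tensorInner V m (PiTensorProduct.tprod ℝ x) (PiTensorProduct.tprod ℝ y)
      = ∏ i, inner ℝ (x i) (y i) := by
  simp [tensorInner]

theorem tensorInner_permTensor (σ : Equiv.Perm (Fin m)) (A : ⨂[ℝ]^m V) (x : Fin m → V) :
    tensorInner V m (permTensor σ A) (PiTensorProduct.tprod ℝ (x ∘ σ))
      = tensorInner V m A (PiTensorProduct.tprod ℝ x) := by
  induction A using PiTensorProduct.induction_on with
  | smul_tprod r f =>
    simp only [map_smul, permTensor_tprod, LinearMap.smul_apply, tensorInner_tprod,
      Function.comp_apply]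
    rw [Equiv.prod_comp σ (fun i => inner ℝ (f i) (x i))]
  | add a b ha hb => simp only [map_add, LinearMap.add_apply, ha, hb]

/-- The copositive cone `COP^{n,m}(𝕂)` over a set `𝕂 ⊆ V`: the symmetric tensors `A` of order `m`
with `⟨A, x^{⊗m}⟩ ≥ 0` for all `x ∈ 𝕂`. -/
def copositiveCone (m : ℕ) (𝕂 : Set V) : Set (SymTensor V m) :=
  {A | ∀ x ∈ 𝕂, 0 ≤ tensorInner V m A (PiTensorProduct.tprod ℝ fun _ => x)}

end Tensors

/-! ### Symmetric tensors on `ℝ^r` as symmetric arrays -/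

section Arrays

variable {r m : ℕ}

/-- The canonical basis `e_{i_1} ⊗ ⋯ ⊗ e_{i_m}` of `(ℝ^r)^{⊗m}`. -/
def tensorBasis (r m : ℕ) :
    Module.Basis (Fin m → Fin r) ℝ (⨂[ℝ]^m (EuclideanSpace ℝ (Fin r))) :=
  Basis.piTensorProduct fun _ : Fin m => (EuclideanSpace.basisFun (Fin r) ℝ).toBasis

/-- The `(i_1, …, i_m)`-th element of a symmetric tensor on `ℝ^r`. -/
def symEntry (A : SymTensor (EuclideanSpace ℝ (Fin r)) m) (i : Fin m → Fin r) : ℝ :=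
  (tensorBasis r m).repr A i

theorem tensorBasis_repr_permTensor (τ : Equiv.Perm (Fin m))
    (A : ⨂[ℝ]^m (EuclideanSpace ℝ (Fin r))) (i : Fin m → Fin r) :
    (tensorBasis r m).repr (permTensor τ A) (i ∘ τ) = (tensorBasis r m).repr A i := by
  induction A using PiTensorProduct.induction_on with
  | smul_tprod c f =>
    simp only [map_smul, permTensor_tprod, Finsupp.smul_apply, tensorBasis,
      Basis.piTensorProduct_repr_tprod_apply, Function.comp_apply]
    rw [Equiv.prod_comp τ
      (fun k => ((EuclideanSpace.basisFun (Fin r) ℝ).toBasis.repr (f k)) (i k))]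
  | add a b ha hb => simp only [map_add, Finsupp.add_apply, ha, hb]

theorem symEntry_comp_perm (A : SymTensor (EuclideanSpace ℝ (Fin r)) m)
    (τ : Equiv.Perm (Fin m)) (i : Fin m → Fin r) : symEntry A (i ∘ τ) = symEntry A i := by
  have h := tensorBasis_repr_permTensor τ (A : ⨂[ℝ]^m (EuclideanSpace ℝ (Fin r))) i
  rwa [A.2 τ] at h

/-- The symmetric tensor on `ℝ^r` with a given symmetric array of elements. -/
def symOfArray (a : (Fin m → Fin r) → ℝ)
    (ha : ∀ (τ : Equiv.Perm (Fin m)) (i : Fin m → Fin r), a (i ∘ τ) = a i) :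
    SymTensor (EuclideanSpace ℝ (Fin r)) m :=
  ⟨∑ i, a i • tensorBasis r m i, fun τ => by
    rw [map_sum]
    refine Fintype.sum_equiv (Equiv.arrowCongr τ.symm (Equiv.refl (Fin r))) _ _ fun i => ?_
    have h1 : (Equiv.arrowCongr τ.symm (Equiv.refl (Fin r))) i = i ∘ τ := by
      ext k; simp [Equiv.arrowCongr]
    rw [h1, ha, map_smul]
    simp [tensorBasis, Function.comp_def]⟩

@[simp] theorem symEntry_ofArray (a : (Fin m → Fin r) → ℝ)
    (ha : ∀ (τ : Equiv.Perm (Fin m)) (i : Fin m → Fin r), a (i ∘ τ) = a i) (i : Fin m → Fin r) :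
    symEntry (symOfArray a ha) i = a i := by
  have h := (tensorBasis r m).repr_sum_self a
  exact congrFun h i

theorem symTensor_ext {A B : SymTensor (EuclideanSpace ℝ (Fin r)) m}
    (h : ∀ i, symEntry A i = symEntry B i) : A = B :=
  Subtype.ext ((tensorBasis r m).ext_elem h)

theorem symEntry_add (A B : SymTensor (EuclideanSpace ℝ (Fin r)) m) (i : Fin m → Fin r) :
    symEntry (A + B) i = symEntry A i + symEntry B i := by
  simp [symEntry]

theorem symEntry_smul (t : ℝ) (A : SymTensor (EuclideanSpace ℝ (Fin r)) m) (i : Fin m → Fin r) :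
    symEntry (t • A) i = t * symEntry A i := by
  simp [symEntry]

/-- The linear transformation `P_σ` of the space of symmetric tensors on `ℝ^r` given by
`(P_σ A)_{i_1 ⋯ i_m} = A_{σ(i_1) ⋯ σ(i_m)}`. -/
def permIndex (σ : Equiv.Perm (Fin r)) :
    SymTensor (EuclideanSpace ℝ (Fin r)) m →ₗ[ℝ] SymTensor (EuclideanSpace ℝ (Fin r)) m where
  toFun A := symOfArray (fun i => symEntry A (σ ∘ i))
    fun τ i => symEntry_comp_perm A τ (σ ∘ i)
  map_add' A B := symTensor_ext fun i => by
    simp only [symEntry_add, symEntry_ofArray]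
  map_smul' c A := symTensor_ext fun i => by
    simp only [symEntry_smul, symEntry_ofArray, RingHom.id_apply]

/-- A set `K` of symmetric tensors on `ℝ^r` is permutation-invariant if `P_σ K = K` for all `σ`. -/
def PermutationInvariant (K : Set (SymTensor (EuclideanSpace ℝ (Fin r)) m)) : Prop :=
  ∀ σ : Equiv.Perm (Fin r), permIndex σ '' K = K

/-- The nonnegative orthant of `ℝ^r`. -/
def nonnegOrthant (r : ℕ) : Set (EuclideanSpace ℝ (Fin r)) := {x | ∀ i, 0 ≤ x i}

end Arrays

section Evaluation

variable {V : Type*} [NormedAddCommGroup V] [InnerProductSpace ℝ V] {r m : ℕ}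

/-- For a symmetric tensor `A` over `V` and `c_1, …, c_r ∈ V`, the symmetric tensor
`A(c_1, …, c_r)` on `ℝ^r` whose `(i_1, …, i_m)`-th element is `⟨A, c_{i_1} ⊗ ⋯ ⊗ c_{i_m}⟩`. -/
def tensorAt (A : SymTensor V m) (c : Fin r → V) :
    SymTensor (EuclideanSpace ℝ (Fin r)) m :=
  symOfArray
    (fun i => tensorInner V m A (PiTensorProduct.tprod ℝ fun k => c (i k)))
    fun τ i => by
      have h := tensorInner_permTensor τ (A : ⨂[ℝ]^m V) (fun k => c (i k))
      rw [A.2 τ] at h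
      exact h

end Evaluation

/-! ### Euclidean Jordan algebras -/

/-- A Euclidean Jordan algebra: a real inner product space with a bilinear commutative product
satisfying the Jordan identity, with an identity element, whose inner product is associative.
(Finite-dimensionality is a separate type class.) -/
class EuclideanJordanAlgebra (E : Type*) [NormedAddCommGroup E] [InnerProductSpace ℝ E] where
  /-- the Jordan product -/
  jmul : E →ₗ[ℝ] E →ₗ[ℝ] E
  /-- the identity element -/
  unit : E
  jmul_comm : ∀ x y : E, jmul x y = jmul y x
  jordan : ∀ x y : E, jmul x (jmul (jmul x x) y) = jmul (jmul x x) (jmul x y)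
  unit_jmul : ∀ x : E, jmul unit x = x
  inner_assoc : ∀ x y z : E, inner ℝ (jmul x y) z = inner ℝ x (jmul y z)

namespace EuclideanJordanAlgebra

variable {E : Type*} [NormedAddCommGroup E] [InnerProductSpace ℝ E] [EuclideanJordanAlgebra E]

/-- The powers `x^0 = e`, `x^{k+1} = x ∘ x^k`. -/
def jpow (x : E) : ℕ → E
  | 0 => unit
  | k + 1 => jmul x (jpow x k)

/-- The degree of the minimal polynomial of `x`: the least `k` such that `e, x, …, x^k` are
linearly dependent. -/
def degree (x : E) : ℕ :=
  sInf {k : ℕ | ¬ LinearIndependent ℝ fun i : Fin (k + 1) => jpow x i}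

variable (E) in
/-- The rank: the largest degree of a minimal polynomial of an element. -/
def rank : ℕ := sSup (Set.range (degree : E → ℕ))

/-- `c` is an idempotent. -/
def IsIdem (c : E) : Prop := jmul c c = c

/-- `c` is a primitive idempotent: a nonzero idempotent that is not the sum of two nonzero
idempotents. -/
def IsPrimitiveIdem (c : E) : Prop :=
  IsIdem c ∧ c ≠ 0 ∧ ¬ ∃ a b : E, IsIdem a ∧ IsIdem b ∧ a ≠ 0 ∧ b ≠ 0 ∧ c = a + b

/-- `c_1, …, c_k` is a Jordan frame: a complete system of orthogonal primitive idempotents. -/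
def IsJordanFrame {k : ℕ} (c : Fin k → E) : Prop :=
  (∀ i, IsPrimitiveIdem (c i)) ∧ (∀ i j, i ≠ j → jmul (c i) (c j) = 0) ∧ ∑ i, c i = unit

variable (E) in
/-- The set `𝔉(E)` of ordered Jordan frames. -/
def orderedJordanFrames : Set (Fin (rank E) → E) := {c | IsJordanFrame c}

variable (E) in
/-- The symmetric cone `E_+ = {x ∘ x | x ∈ E}`. -/
def symmetricCone : Set E := Set.range fun x : E => jmul x x

/-- `𝔉c` is a complete set of representatives of the orbits of the symmetric group acting on the
ordered Jordan frames by permuting their members: it consists of ordered Jordan frames and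
contains exactly one element of each orbit. -/
def IsCompleteRepresentatives (𝔉c : Set (Fin (rank E) → E)) : Prop :=
  𝔉c ⊆ orderedJordanFrames E ∧
    ∀ c ∈ orderedJordanFrames E, ∃! d, d ∈ 𝔉c ∧ ∃ σ : Equiv.Perm (Fin (rank E)), d = c ∘ σ

end EuclideanJordanAlgebra

end

open scoped TensorProduct

noncomputable section

namespace EuclideanJordanAlgebra

open Polynomial

variable {E : Type*} [NormedAddCommGroup E] [InnerProductSpace ℝ E] [EuclideanJordanAlgebra E]

/-! ### Power associativity -/

/-! Everything rests on the spectral theorem `exists_isJordanFrame_eq_sum`: each element is a real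
combination of a Jordan frame of length `rank E`. Squaring then shows that the symmetric cone is the
union of the orthants spanned by frames, and `tensorInner_tensorAt` identifies the form of `A` on
such an orthant with that of `tensorAt A c` on the nonnegative orthant. Independence of the
admissible set is equivariance, `permIndex_tensorAt`.

For the spectral theorem, power associativity and diagonalisation of the symmetric operator `mulOp
x` write `x` over a system of orthogonal idempotents. If `e, x, …, x^(rank - 1)` are independent,
the system has exactly `rank E` members, and a system of that maximal length consists of primitive
idempotents. Such `x` are dense and the systems form a compact set, so a limit covers all `x`. -/

theorem jmul_unit (x : E) : jmul x unit = x := by rw [jmul_comm, unit_jmul]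

/-- The Jordan identity, polarized once. -/
theorem jordan_polarized (x y w : E) :
    jmul y (jmul (jmul x x) w) - jmul (jmul x x) (jmul y w)
      + (2 : ℝ) • (jmul x (jmul (jmul x y) w) - jmul (jmul x y) (jmul x w)) = 0 := by
  have h1 := jordan (x + y) w
  have h2 := jordan (x - y) w
  have h3 := jordan y w
  simp only [map_add, map_sub, LinearMap.add_apply, LinearMap.sub_apply, jmul_comm y x] at h1 h2 h3
  -- The half difference keeps the terms odd in `y`; subtracting the cubic one leaves the linear
  -- part.
  linear_combination (norm := module) (1 / 2 : ℝ) • h1 - (1 / 2 : ℝ) • h2 - h3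

/-- Subtracting two polarized identities with `y` and `w` exchanged cancels the symmetric terms. The
outcome expresses multiplication by `(x ∘ x) ∘ y` through simpler multiplications, which drives the
induction on powers. -/
theorem jmul_sq_jmul_apply (x y w : E) :
    jmul (jmul (jmul x x) y) w = jmul y (jmul (jmul x x) w)
      + (2 : ℝ) • jmul x (jmul (jmul x y) w) - (2 : ℝ) • jmul x (jmul y (jmul x w)) := by
  have h1 := jordan_polarized x y w
  have h2 := jordan_polarized x w y
  rw [jmul_comm w (jmul (jmul x x) y), jmul_comm w y, jmul_comm (jmul x w) y,
    jmul_comm (jmul x w) (jmul x y)] at h2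
  linear_combination (norm := module) h2 - h1

/-- Multiplication by `x`, as an element of the algebra of endomorphisms. -/
def mulOp (x : E) : Module.End ℝ E := jmul x

@[simp] theorem mulOp_apply (x y : E) : mulOp x y = jmul x y := rfl

theorem commute_mulOp_sq (x : E) : Commute (mulOp x) (mulOp (jmul x x)) :=
  LinearMap.ext fun y => jordan x y

theorem mulOp_sq_jmul (x y : E) :
    mulOp (jmul (jmul x x) y) = mulOp y * mulOp (jmul x x)
      + (2 : ℝ) • (mulOp x * mulOp (jmul x y)) - (2 : ℝ) • (mulOp x * (mulOp y * mulOp x)) :=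
  LinearMap.ext fun w => jmul_sq_jmul_apply x y w

theorem jpow_one (x : E) : jpow x 1 = x := jmul_unit x

theorem jpow_eq_mulOp_pow (x : E) (k : ℕ) : jpow x k = (mulOp x ^ k) unit := by
  induction k with
  | zero => rfl
  | succ k ih => rw [jpow, ih, pow_succ']; rfl

theorem mulOp_unit : mulOp (unit : E) = 1 := LinearMap.ext fun y => unit_jmul y

theorem sq_jmul_jpow {x : E} {k : ℕ} (h : Commute (mulOp x) (mulOp (jpow x k))) :
    jmul (jmul x x) (jpow x k) = jpow x (k + 2) := by
  have := LinearMap.congr_fun h.eq x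
  simp only [Module.End.mul_apply, mulOp_apply] at this
  rw [jpow, jpow, jmul_comm (jmul x x), ← this, jmul_comm _ x]

/-- Since `x^(k+2) = (x ∘ x) ∘ x^k`, `mulOp_sq_jmul` builds its operator from those of `x`, `x ∘ x`,
`x^k` and `x^(k+1)`; hence the induction carries two consecutive powers and both commutation
relations. -/
theorem commute_mulOp_jpow_aux (x : E) (k : ℕ) :
    (Commute (mulOp x) (mulOp (jpow x k)) ∧ Commute (mulOp (jmul x x)) (mulOp (jpow x k))) ∧
    (Commute (mulOp x) (mulOp (jpow x (k + 1))) ∧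
      Commute (mulOp (jmul x x)) (mulOp (jpow x (k + 1)))) := by
  induction k with
  | zero =>
    rw [zero_add, jpow_one, jpow, mulOp_unit]
    exact ⟨⟨Commute.one_right _, Commute.one_right _⟩, Commute.refl _, (commute_mulOp_sq x).symm⟩
  | succ k ih =>
    obtain ⟨⟨h1, h2⟩, h3, h4⟩ := ih
    refine ⟨⟨h3, h4⟩, ?_⟩
    rw [← sq_jmul_jpow h1, mulOp_sq_jmul]
    have hx := commute_mulOp_sq x
    constructor
    · exact ((h1.mul_right hx).add_right (((Commute.refl _).mul_right h3).smul_right _)).sub_right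
        (((Commute.refl _).mul_right (h1.mul_right (Commute.refl _))).smul_right _)
    · exact ((h2.mul_right (Commute.refl _)).add_right ((hx.symm.mul_right h4).smul_right _)).sub_right
        ((hx.symm.mul_right (h2.mul_right hx.symm)).smul_right _)

theorem commute_mulOp_jpow (x : E) (k : ℕ) : Commute (mulOp x) (mulOp (jpow x k)) :=
  (commute_mulOp_jpow_aux x k).1.1

theorem jpow_jmul_jpow (x : E) (a b : ℕ) : jmul (jpow x a) (jpow x b) = jpow x (a + b) := by
  have h := LinearMap.congr_fun ((commute_mulOp_jpow x a).pow_left b).eq unit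
  simp only [Module.End.mul_apply, mulOp_apply, jmul_unit] at h
  rw [jpow_eq_mulOp_pow x b, ← h, jpow_eq_mulOp_pow x a, add_comm a b, jpow_eq_mulOp_pow, pow_add]
  rfl

/-- Evaluation of a polynomial at an element of the algebra. -/
def polyEval (x : E) : ℝ[X] →ₗ[ℝ] E :=
  (LinearMap.applyₗ (unit : E)).comp (aeval (mulOp x)).toLinearMap

theorem polyEval_apply (x : E) (p : ℝ[X]) : polyEval x p = aeval (mulOp x) p unit := rfl

theorem polyEval_X_pow (x : E) (k : ℕ) : polyEval x (X ^ k) = jpow x k := by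
  rw [polyEval_apply, map_pow, aeval_X, jpow_eq_mulOp_pow]

theorem polyEval_mul (x : E) (p q : ℝ[X]) :
    polyEval x (p * q) = jmul (polyEval x p) (polyEval x q) := by
  induction p using Polynomial.induction_on' with
  | add p₁ p₂ h₁ h₂ => rw [add_mul, map_add, map_add, h₁, h₂, map_add, LinearMap.add_apply]
  | monomial a s =>
    induction q using Polynomial.induction_on' with
    | add q₁ q₂ h₁ h₂ => rw [mul_add, map_add, map_add, h₁, h₂, map_add]
    | monomial b t =>
      rw [monomial_mul_monomial, ← smul_X_eq_monomial, ← smul_X_eq_monomial, ← smul_X_eq_monomial]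
      simp only [map_smul, LinearMap.smul_apply, polyEval_X_pow, jpow_jmul_jpow, smul_smul, mul_comm]

/-! ### Complete systems of orthogonal idempotents -/

/-- A complete system of nonzero orthogonal idempotents. -/
structure IsIdemSystem {ι : Type*} [Fintype ι] (c : ι → E) : Prop where
  idem : ∀ i, IsIdem (c i)
  ne_zero : ∀ i, c i ≠ 0
  orth : ∀ i j, i ≠ j → jmul (c i) (c j) = 0
  sum_eq : ∑ i, c i = unit

theorem IsIdemSystem.comp_equiv {ι κ : Type*} [Fintype ι] [Fintype κ] {c : ι → E}
    (hc : IsIdemSystem c) (e : κ ≃ ι) : IsIdemSystem (c ∘ e) where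
  idem i := hc.idem _
  ne_zero i := hc.ne_zero _
  orth i j h := hc.orth _ _ fun h' => h (e.injective h')
  sum_eq := by rw [← hc.sum_eq]; exact Equiv.sum_comp e c

theorem IsIdemSystem.jmul_sum {ι : Type*} [Fintype ι] {c : ι → E} (hc : IsIdemSystem c)
    (a : ι → ℝ) (i : ι) : jmul (c i) (∑ j, a j • c j) = a i • c i := by
  rw [map_sum, Finset.sum_eq_single i]
  · rw [map_smul, hc.idem i]
  · intro j _ hj
    rw [map_smul, hc.orth i j hj.symm, smul_zero]
  · simp

theorem IsIdemSystem.sum_jmul_sum {ι : Type*} [Fintype ι] {c : ι → E} (hc : IsIdemSystem c)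
    (a b : ι → ℝ) : jmul (∑ i, a i • c i) (∑ j, b j • c j) = ∑ i, (a i * b i) • c i := by
  simp only [map_sum (jmul (E := E)), LinearMap.sum_apply, map_smul (jmul (E := E)),
    LinearMap.smul_apply, hc.jmul_sum, smul_smul]

theorem IsIdemSystem.jpow_sum {ι : Type*} [Fintype ι] {c : ι → E} (hc : IsIdemSystem c)
    (a : ι → ℝ) (k : ℕ) : jpow (∑ i, a i • c i) k = ∑ i, (a i ^ k) • c i := by
  induction k with
  | zero => simpa [jpow] using hc.sum_eq.symm
  | succ k ih =>
    rw [jpow, ih, hc.sum_jmul_sum]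
    exact Finset.sum_congr rfl fun i _ => by rw [pow_succ']

theorem mulOp_isSymmetric (x : E) : (mulOp x).IsSymmetric := fun y z => by
  rw [mulOp_apply, mulOp_apply, jmul_comm, inner_assoc]

/-! ### Degree and rank -/

theorem linearIndependent_jpow_degree (x : E) :
    LinearIndependent ℝ fun i : Fin (degree x) => jpow x i := by
  rcases Nat.eq_zero_or_eq_succ_pred (degree x) with h | h
  -- Degree `0` also covers the default value of `sInf`; the family is then empty.
  · rw [h]
    exact linearIndependent_empty_type
  · have hlt : (degree x).pred < degree x := by omega
    have := Nat.notMem_of_lt_sInf hlt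
    simp only [Set.mem_ofPred_eq, not_not] at this
    rw [h]
    exact this

section FiniteDimensional

variable [FiniteDimensional ℝ E]

/-- The spectral decomposition of all powers of an element. -/
theorem exists_idemSystem_jpow (x : E) :
    ∃ (S : Finset ℝ) (d : S → E), IsIdemSystem d ∧
      ∀ k, jpow x k = ∑ μ : S, ((μ : ℝ) ^ k) • d μ := by
  classical
  have hT := mulOp_isSymmetric x
  let v := hT.eigenvectorBasis rfl
  let l := hT.eigenvalues rfl
  let S : Finset ℝ := Finset.univ.image l
  -- A polynomial vanishing on the spectrum kills an eigenbasis, so `polyEval x p` depends only on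
  -- the values of `p` on `S`.
  have hzero : ∀ p : ℝ[X], (∀ μ ∈ S, p.eval μ = 0) → polyEval x p = 0 := by
    intro p hp
    have : aeval (mulOp x) p = 0 := by
      refine v.toBasis.ext fun i => ?_
      rw [OrthonormalBasis.coe_toBasis,
        Module.End.aeval_apply_of_hasEigenvector (hT.hasEigenvector_eigenvectorBasis rfl i)]
      have h0 : p.eval (l i) = 0 := hp _ (Finset.mem_image_of_mem _ (Finset.mem_univ i))
      simp only [LinearMap.zero_apply]
      erw [h0, zero_smul]
    rw [polyEval_apply, this, LinearMap.zero_apply]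
  have heq : ∀ p q : ℝ[X], (∀ μ ∈ S, p.eval μ = q.eval μ) → polyEval x p = polyEval x q := by
    intro p q h
    rw [← sub_eq_zero, ← map_sub]
    exact hzero _ fun μ hμ => by rw [eval_sub, h μ hμ, sub_self]
  -- Lagrange basis polynomials are indicator functions on `S`, so their images are orthogonal
  -- idempotents.
  let d : ℝ → E := fun μ => polyEval x (Lagrange.basis S id μ)
  have hinj : Set.InjOn (id : ℝ → ℝ) S := Set.injOn_id _
  have hpoly : ∀ p : ℝ[X], polyEval x p = ∑ μ ∈ S, p.eval μ • d μ := by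
    intro p
    rw [heq p (Lagrange.interpolate S id fun μ => p.eval μ) fun μ hμ =>
      (Lagrange.eval_interpolate_at_node (v := id) (fun μ => p.eval μ) hinj hμ).symm, Lagrange.interpolate_apply,
      map_sum]
    exact Finset.sum_congr rfl fun μ _ => by rw [← smul_eq_C_mul, map_smul]
  have heval : ∀ μ ∈ S, ∀ ν ∈ S, (Lagrange.basis S id μ).eval ν = if μ = ν then 1 else 0 := by
    intro μ hμ ν hν
    split_ifs with h
    · subst h; exact Lagrange.eval_basis_self hinj hμ
    · exact Lagrange.eval_basis_of_ne (v := id) h hν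
  -- An eigenvalue of `mulOp x` may contribute nothing to `x` itself; those with zero idempotent are
  -- dropped.
  let S' := S.filter fun μ => d μ ≠ 0
  have hS' : ∀ μ : S', (μ : ℝ) ∈ S := fun μ => (Finset.mem_filter.1 μ.2).1
  have hsum : ∀ a : ℝ → ℝ, ∑ μ ∈ S, a μ • d μ = ∑ μ : S', a μ • d μ := by
    intro a
    rw [Finset.sum_coe_sort S' (fun μ => a μ • d μ)]
    refine (Finset.sum_subset (Finset.filter_subset _ _) fun μ hμ hμ' => ?_).symm
    have : d μ = 0 := by
      by_contra h
      exact hμ' (Finset.mem_filter.2 ⟨hμ, h⟩)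
    rw [this, smul_zero]
  have hpow : ∀ k, jpow x k = ∑ μ : S', ((μ : ℝ) ^ k) • d μ := by
    intro k
    rw [← polyEval_X_pow, hpoly, ← hsum fun μ => μ ^ k]
    simp only [eval_pow, eval_X]
  refine ⟨S', fun μ => d μ, ⟨fun μ => ?_, fun μ => (Finset.mem_filter.1 μ.2).2, fun μ ν h => ?_, ?_⟩,
    hpow⟩
  · change jmul (polyEval x _) (polyEval x _) = polyEval x _
    rw [← polyEval_mul]
    refine heq _ _ fun ν hν => ?_
    rw [eval_mul, heval _ (hS' μ) _ hν]
    split_ifs <;> simp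
  · change jmul (polyEval x _) (polyEval x _) = 0
    rw [← polyEval_mul]
    refine hzero _ fun κ hκ => ?_
    rw [eval_mul, heval _ (hS' μ) _ hκ, heval _ (hS' ν) _ hκ]
    have : (μ : ℝ) ≠ ν := fun h' => h (Subtype.ext h')
    split_ifs with h1 h2 <;> simp
    exact this (h1.trans h2.symm)
  · simpa [jpow] using (hpow 0).symm

theorem not_linearIndependent_jpow_finrank (x : E) :
    ¬ LinearIndependent ℝ fun i : Fin (Module.finrank ℝ E + 1) => jpow x i := fun h => by
  have := h.fintype_card_le_finrank
  simp at this

theorem le_degree_of_linearIndependent {x : E} {k : ℕ}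
    (h : LinearIndependent ℝ fun i : Fin k => jpow x i) : k ≤ degree x := by
  -- Finite dimension makes the set nonempty, so that `sInf` is a true minimum.
  refine le_csInf ⟨_, not_linearIndependent_jpow_finrank x⟩ fun j hj => ?_
  by_contra! hlt
  exact hj (h.comp (Fin.castLE (Nat.succ_le_of_lt hlt)) (Fin.castLE_injective _))

theorem bddAbove_range_degree : BddAbove (Set.range (degree : E → ℕ)) := by
  refine ⟨Module.finrank ℝ E, ?_⟩
  rintro _ ⟨x, rfl⟩
  exact Nat.sInf_le (not_linearIndependent_jpow_finrank x)

theorem degree_le_rank (x : E) : degree x ≤ rank E :=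
  le_csSup bddAbove_range_degree ⟨x, rfl⟩

variable (E) in
theorem exists_linearIndependent_jpow_rank :
    ∃ y : E, LinearIndependent ℝ fun i : Fin (rank E) => jpow y i := by
  obtain ⟨y, hy⟩ := Nat.sSup_mem (Set.range_nonempty (degree : E → ℕ)) bddAbove_range_degree
  refine ⟨y, ?_⟩
  have : rank E = degree y := hy.symm
  rw [this]
  exact linearIndependent_jpow_degree y

/-- A combination with distinct coefficients has as many independent powers as there are
idempotents, by Vandermonde. -/
theorem IsIdemSystem.card_le_rank {ι : Type*} [Fintype ι] {c : ι → E} (hc : IsIdemSystem c) :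
    Fintype.card ι ≤ rank E := by
  have hc' := hc.comp_equiv (Fintype.equivFin ι).symm
  generalize c ∘ (Fintype.equivFin ι).symm = d at hc'
  let a : Fin (Fintype.card ι) → ℝ := fun i => (i : ℝ)
  have ha : Function.Injective a := fun i j h => Fin.ext (Nat.cast_injective (R := ℝ) h)
  refine le_trans (le_degree_of_linearIndependent (x := ∑ i, a i • d i) ?_) (degree_le_rank _)
  rw [Fintype.linearIndependent_iff]
  intro g hg
  refine congrFun (Matrix.eq_zero_of_forall_index_sum_mul_pow_eq_zero (v := g) ha fun i => ?_)
  -- Multiplying the relation by `d i` isolates the value at `a i` of the polynomial with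
  -- coefficients `g`.
  have h1 : jmul (d i) (∑ j, (∑ k : Fin (Fintype.card ι), g k * a j ^ (k : ℕ)) • d j) = 0 := by
    rw [← map_zero (jmul (d i)), ← hg]
    congr 1
    simp only [hc'.jpow_sum, Finset.sum_smul, Finset.smul_sum, smul_smul]
    exact Finset.sum_comm
  rw [hc'.jmul_sum] at h1
  exact (smul_eq_zero.1 h1).resolve_right (hc'.ne_zero i)

/-- The spectral idempotents span the `rank E` independent powers, so there are at least that many;
`card_le_rank` gives the reverse bound. -/
theorem exists_idemSystem_rank_of_linearIndependent {x : E}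
    (h : LinearIndependent ℝ fun i : Fin (rank E) => jpow x i) :
    ∃ (d : Fin (rank E) → E) (a : Fin (rank E) → ℝ), IsIdemSystem d ∧ x = ∑ i, a i • d i := by
  obtain ⟨S, d, hd, hpow⟩ := exists_idemSystem_jpow x
  have hle : rank E ≤ Fintype.card S := by
    have h1 : Set.range (fun i : Fin (rank E) => jpow x i) ⊆ Submodule.span ℝ (Set.range d) := by
      rintro _ ⟨i, rfl⟩
      dsimp only
      rw [hpow]
      exact Submodule.sum_mem _ fun μ _ =>
        Submodule.smul_mem _ _ (Submodule.subset_span ⟨μ, rfl⟩)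
    calc rank E = (Set.range fun i : Fin (rank E) => jpow x i).finrank ℝ := by
          rw [Set.finrank, finrank_span_eq_card h, Fintype.card_fin]
      _ ≤ (Set.range d).finrank ℝ := Submodule.finrank_mono (Submodule.span_le.2 h1)
      _ ≤ Fintype.card S := finrank_range_le_card d
  let e : Fin (rank E) ≃ S := (Fintype.equivFinOfCardEq (le_antisymm hd.card_le_rank hle)).symm
  refine ⟨d ∘ e, fun i => (e i : ℝ), hd.comp_equiv e, ?_⟩
  have h1 := hpow 1
  simp only [jpow_one, pow_one] at h1
  rw [h1]
  exact (Equiv.sum_comp e fun μ : S => (μ : ℝ) • d μ).symm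

end FiniteDimensional

end EuclideanJordanAlgebra

namespace EuclideanJordanAlgebra

open Filter Topology

variable {E : Type*} [NormedAddCommGroup E] [InnerProductSpace ℝ E] [EuclideanJordanAlgebra E]

/-! ### Primitivity of the members of systems of maximal length -/

/-- Elements of the Peirce spaces of `c` for the eigenvalues `1` and `0` annihilate each other. -/
theorem peirce_one_jmul_zero {c a y : E} (hc : IsIdem c) (ha : jmul c a = a) (hy : jmul c y = 0) :
    jmul a y = 0 := by
  have hc' : jmul c c = c := hc
  -- After substitution, `h1` says `a ∘ y = c ∘ (a ∘ y)` and `h2` says `c ∘ (a ∘ y) = 0`.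
  have h1 := jordan_polarized c y a
  have h2 := jordan_polarized c a y
  rw [hc', hy, ha] at h1
  rw [hc', ha, hy] at h2
  simp only [map_zero, LinearMap.zero_apply, sub_self, smul_zero, add_zero, sub_zero, zero_sub]
    at h1 h2
  rw [jmul_comm y a] at h1
  have h3 : jmul c (jmul a y) = 0 := by
    have : (2 : ℝ) • jmul c (jmul a y) - jmul c (jmul a y) = 0 := by
      rw [← h2]; abel
    linear_combination (norm := module) this
  rw [h3, sub_zero] at h1
  exact h1

theorem jmul_eq_zero_of_isIdem_add {a b : E} (ha : IsIdem a) (hb : IsIdem b)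
    (hab : IsIdem (a + b)) : jmul a b = 0 := by
  have ha' : jmul a a = a := ha
  have hb' : jmul b b = b := hb
  have h : jmul (a + b) (a + b) = a + b := hab
  simp only [map_add, LinearMap.add_apply, ha', hb', jmul_comm b a] at h
  linear_combination (norm := module) (1 / 2 : ℝ) • h

/-- A splitting `c i = a + b` would refine the system to `rank E + 1` members: `a` and `b` lie in
the Peirce `1`-space of `c i`, hence annihilate every other `c j`. -/
theorem IsIdemSystem.isPrimitiveIdem [FiniteDimensional ℝ E] {c : Fin (rank E) → E}
    (hc : IsIdemSystem c) (i : Fin (rank E)) : IsPrimitiveIdem (c i) := by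
  refine ⟨hc.idem i, hc.ne_zero i, ?_⟩
  rintro ⟨a, b, ha, hb, ha0, hb0, hab⟩
  have horth : jmul a b = 0 := jmul_eq_zero_of_isIdem_add ha hb (hab ▸ hc.idem i)
  have hia : jmul (c i) a = a := by
    rw [hab, map_add, LinearMap.add_apply, jmul_comm b a, horth, add_zero]; exact ha
  have hib : jmul (c i) b = b := by
    rw [hab, map_add, LinearMap.add_apply, horth, zero_add]; exact hb
  have haj : ∀ j, j ≠ i → jmul a (c j) = 0 := fun j hj =>
    peirce_one_jmul_zero (hc.idem i) hia (hc.orth i j hj.symm)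
  have hbj : ∀ j, j ≠ i → jmul b (c j) = 0 := fun j hj =>
    peirce_one_jmul_zero (hc.idem i) hib (hc.orth i j hj.symm)
  let d : Option (Fin (rank E)) → E := fun o => o.elim b (Function.update c i a)
  have hd_self : d (some i) = a := Function.update_self ..
  have hd_ne : ∀ j, j ≠ i → d (some j) = c j := fun j hj => Function.update_of_ne hj ..
  have hd_none : d none = b := rfl
  have hd : IsIdemSystem d := by
    refine ⟨fun o => ?_, fun o => ?_, fun o o' h => ?_, ?_⟩
    · rcases o with _ | j
      · exact hb
      · by_cases hj : j = i
        · rw [hj, hd_self]; exact ha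
        · rw [hd_ne j hj]; exact hc.idem j
    · rcases o with _ | j
      · exact hb0
      · by_cases hj : j = i
        · rw [hj, hd_self]; exact ha0
        · rw [hd_ne j hj]; exact hc.ne_zero j
    · have key : ∀ j, jmul (d none) (d (some j)) = 0 := fun j => by
        rw [hd_none]
        by_cases hj : j = i
        · rw [hj, hd_self, jmul_comm, horth]
        · rw [hd_ne j hj, hbj j hj]
      rcases o with _ | j <;> rcases o' with _ | k
      · exact absurd rfl h
      · exact key k
      · rw [jmul_comm, key j]
      · have hjk : j ≠ k := fun h' => h (congrArg some h')
        by_cases hj : j = i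
        · have hk : k ≠ i := fun h' => hjk (hj.trans h'.symm)
          rw [hj, hd_self, hd_ne k hk, haj k hk]
        · rw [hd_ne j hj]
          by_cases hk : k = i
          · rw [hk, hd_self, jmul_comm, haj j hj]
          · rw [hd_ne k hk, hc.orth j k hjk]
    · rw [Fintype.sum_option, hd_none, ← hc.sum_eq,
        ← Finset.add_sum_erase _ _ (Finset.mem_univ i),
        ← Finset.add_sum_erase Finset.univ c (Finset.mem_univ i), hd_self, hab, ← add_assoc,
        add_comm b a]
      congr 1
      exact Finset.sum_congr rfl fun j hj => hd_ne j (Finset.ne_of_mem_erase hj)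
  have := hd.card_le_rank
  simp at this

theorem IsIdemSystem.isJordanFrame [FiniteDimensional ℝ E] {c : Fin (rank E) → E}
    (hc : IsIdemSystem c) : IsJordanFrame c :=
  ⟨hc.isPrimitiveIdem, hc.orth, hc.sum_eq⟩

theorem IsJordanFrame.isIdemSystem {k : ℕ} {c : Fin k → E} (hc : IsJordanFrame c) :
    IsIdemSystem c :=
  ⟨fun i => (hc.1 i).1, fun i => (hc.1 i).2.1, hc.2.1, hc.2.2⟩

/-! ### Norm bounds for idempotents -/

/-- Associativity gives `⟨c, c⟩ = ⟨c, e⟩`; Cauchy–Schwarz does the rest. -/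
theorem norm_le_of_isIdem {c : E} (hc : IsIdem c) : ‖c‖ ≤ ‖(unit : E)‖ := by
  have hc' : jmul c c = c := hc
  have h : inner ℝ c c = inner ℝ c (unit : E) := by
    have h := inner_assoc c c (unit : E)
    rw [hc', jmul_unit] at h
    exact h.symm
  rcases eq_or_ne c 0 with rfl | h0
  · simp
  · have h1 := real_inner_le_norm c (unit : E)
    rw [← h, real_inner_self_eq_norm_mul_norm] at h1
    exact le_of_mul_le_mul_left h1 (norm_pos_iff.2 h0)

theorem IsIdemSystem.inner_sum {ι : Type*} [Fintype ι] {c : ι → E} (hc : IsIdemSystem c)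
    (a : ι → ℝ) (i : ι) : inner ℝ (c i) (∑ j, a j • c j) = a i * inner ℝ (c i) (c i) := by
  have h : jmul (c i) (c i) = c i := hc.idem i
  conv_lhs => rw [← h, inner_assoc, hc.jmul_sum]
  rw [inner_smul_right]

section FiniteDimensional

variable [FiniteDimensional ℝ E]

variable (E) in
/-- The Jordan product as a continuous bilinear map. -/
def jmulL : E →L[ℝ] E →L[ℝ] E :=
  LinearMap.toContinuousLinearMap (LinearMap.toContinuousLinearMap.toLinearMap ∘ₗ jmul)

@[simp] theorem jmulL_apply (x y : E) : jmulL E x y = jmul x y := rfl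

variable (E) in
-- From `c = c ∘ c`, a bound on the product bounds nonzero idempotents away from `0`, which turns `c
-- ≠ 0` into a closed condition for the compactness argument.
theorem exists_pos_le_norm_of_isIdem :
    ∃ δ : ℝ, 0 < δ ∧ ∀ c : E, IsIdem c → c ≠ 0 → δ ≤ ‖c‖ := by
  refine ⟨1 / (‖jmulL E‖ + 1), by positivity, fun c hc h0 => ?_⟩
  have hc' : jmul c c = c := hc
  have h1 := (jmulL E).le_opNorm₂ c c
  rw [jmulL_apply, hc'] at h1
  have hpos := norm_pos_iff.2 h0
  have h2 : 1 ≤ ‖jmulL E‖ * ‖c‖ := by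
    refine le_of_mul_le_mul_right ?_ hpos
    rwa [one_mul]
  rw [div_le_iff₀ (by positivity)]
  nlinarith

variable (E) in
theorem isCompact_setOf_isIdemSystem (ι : Type*) [Fintype ι] :
    IsCompact {c : ι → E | IsIdemSystem c} := by
  obtain ⟨δ, hδ, hδE⟩ := exists_pos_le_norm_of_isIdem E
  have hset : {c : ι → E | IsIdemSystem c} =
      {c | ∀ i, jmul (c i) (c i) = c i} ∩ {c | ∀ i, δ ≤ ‖c i‖} ∩
        {c | ∀ i j, i ≠ j → jmul (c i) (c j) = 0} ∩ {c | ∑ i, c i = unit} := by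
    ext c
    constructor
    · intro h
      exact ⟨⟨⟨h.idem, fun i => hδE _ (h.idem i) (h.ne_zero i)⟩, h.orth⟩, h.sum_eq⟩
    · rintro ⟨⟨⟨h1, h2⟩, h3⟩, h4⟩
      exact ⟨h1, fun i => norm_pos_iff.1 (hδ.trans_le (h2 i)), h3, h4⟩
  have hmul : ∀ i j : ι, Continuous fun c : ι → E => jmul (c i) (c j) := fun i j =>
    
    ((jmulL E).continuous.comp (continuous_apply i)).clm_apply (continuous_apply j)
  refine Metric.isCompact_of_isClosed_isBounded ?_ ?_
  · rw [hset]
    refine ((IsClosed.inter ?_ ?_).inter ?_).inter ?_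
    · simp only [Set.ofPred_forall]
      exact isClosed_iInter fun i => isClosed_eq (hmul i i) (continuous_apply i)
    · simp only [Set.ofPred_forall]
      exact isClosed_iInter fun i => isClosed_le continuous_const (continuous_apply i).norm
    · simp only [Set.ofPred_forall]
      exact isClosed_iInter fun i => isClosed_iInter fun j => isClosed_iInter fun _ =>
        isClosed_eq (hmul i j) continuous_const
    · exact isClosed_eq (continuous_finsetSum _ fun i _ => continuous_apply i) continuous_const
  · refine (Metric.isBounded_closedBall (x := (0 : ι → E)) (r := ‖(unit : E)‖)).subset ?_
    intro c hc
    rw [mem_closedBall_zero_iff, pi_norm_le_iff_of_nonneg (norm_nonneg _)]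
    exact fun i => norm_le_of_isIdem (hc.idem i)

/-! ### The spectral theorem -/

theorem analyticAt_jpow (k : ℕ) (x : E) : AnalyticAt ℝ (fun y : E => jpow y k) x := by
  induction k with
  | zero => exact analyticAt_const
  | succ k ih =>
    exact ((jmulL E).analyticAt_bilinear (x, jpow x k)).comp₂ analyticAt_id ih

theorem analyticAt_det_gram_jpow (k : ℕ) (x : E) :
    AnalyticAt ℝ (fun y : E => (Matrix.gram ℝ fun i : Fin k => jpow y i).det) x := by
  simp only [Matrix.det_apply, Matrix.gram_apply]
  refine Finset.analyticAt_fun_sum _ fun σ _ => ?_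
  have h : AnalyticAt ℝ (fun y : E =>
      ∏ i : Fin k, inner ℝ (jpow y (σ i : Fin k)) (jpow y i)) x :=
    Finset.analyticAt_fun_prod _ fun i _ =>
      ((innerSL ℝ).analyticAt_bilinear (jpow x (σ i : Fin k), jpow x i)).comp₂
        (analyticAt_jpow _ x) (analyticAt_jpow _ x)
  rcases Int.units_eq_one_or (Equiv.Perm.sign σ) with hs | hs <;> rw [hs]
  · simpa using h
  · simp only [Units.neg_smul, one_smul]
    exact h.fun_neg

variable (E) in
-- Independence of the powers means a nonzero Gram determinant, which is analytic in `x`. Vanishing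
-- near one point would force vanishing everywhere, against the element attaining the rank.
theorem dense_linearIndependent_jpow :
    Dense {x : E | LinearIndependent ℝ fun i : Fin (rank E) => jpow x i} := by
  intro x
  by_contra hx
  rw [mem_closure_iff_frequently, not_frequently] at hx
  have h0 : ∀ᶠ y in 𝓝 x, (Matrix.gram ℝ fun i : Fin (rank E) => jpow y i).det = 0 := by
    filter_upwards [hx] with y hy
    by_contra h
    exact hy (Matrix.det_gram_ne_zero_iff_linearIndependent.1 h)
  have h1 : AnalyticOnNhd ℝ
      (fun y : E => (Matrix.gram ℝ fun i : Fin (rank E) => jpow y i).det) Set.univ :=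
    fun y _ => analyticAt_det_gram_jpow _ y
  have h2 := h1.eqOn_zero_of_preconnected_of_eventuallyEq_zero isPreconnected_univ
    (Set.mem_univ x) h0
  obtain ⟨y, hy⟩ := exists_linearIndependent_jpow_rank E
  exact Matrix.det_gram_ne_zero_iff_linearIndependent.2 hy (h2 (Set.mem_univ y))

/-- Every element is a linear combination of the members of a Jordan frame. -/
theorem exists_isJordanFrame_eq_sum (x : E) :
    ∃ (c : Fin (rank E) → E) (a : Fin (rank E) → ℝ), IsJordanFrame c ∧ x = ∑ i, a i • c i := by
  obtain ⟨u, hu, hux⟩ := mem_closure_iff_seq_limit.1 (dense_linearIndependent_jpow E x)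
  choose d a hd hda using fun n => exists_idemSystem_rank_of_linearIndependent (hu n)
  obtain ⟨c, hc, φ, hφ, hlim⟩ := (isCompact_setOf_isIdemSystem E (Fin (rank E))).tendsto_subseq
    (x := d) hd
  have hc' : IsIdemSystem c := hc
  -- Orthogonality recovers the coefficients as these quotients, which are continuous in the frame
  -- and the element, so they pass to the limit.
  refine ⟨c, fun i => inner ℝ (c i) x / inner ℝ (c i) (c i), hc'.isJordanFrame, ?_⟩
  have hux' := hux.comp hφ.tendsto_atTop
  refine tendsto_nhds_unique hux' ?_
  have hcoord : ∀ n, u n = ∑ i, (inner ℝ (d n i) (u n) / inner ℝ (d n i) (d n i)) • d n i := by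
    intro n
    conv_lhs => rw [hda n]
    refine Finset.sum_congr rfl fun i _ => ?_
    rw [hda n, (hd n).inner_sum, mul_div_cancel_right₀]
    exact inner_self_ne_zero.2 ((hd n).ne_zero i)
  have hdi : ∀ i, Tendsto (fun n => d (φ n) i) atTop (𝓝 (c i)) := fun i =>
    (tendsto_pi_nhds.1 hlim) i
  have h : Tendsto (fun n => ∑ i, (inner ℝ (d (φ n) i) (u (φ n)) /
      inner ℝ (d (φ n) i) (d (φ n) i)) • d (φ n) i) atTop
      (𝓝 (∑ i, (inner ℝ (c i) x / inner ℝ (c i) (c i)) • c i)) :=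
    tendsto_finsetSum _ fun i _ =>
      (((hdi i).inner hux').div ((hdi i).inner (hdi i))
        (inner_self_ne_zero.2 (hc'.ne_zero i))).smul (hdi i)
  exact h.congr fun n => (hcoord (φ n)).symm

/-- The symmetric cone consists of the nonnegative combinations of Jordan frames. -/
theorem mem_symmetricCone_iff (x : E) :
    x ∈ symmetricCone E ↔ ∃ c ∈ orderedJordanFrames E,
      ∃ a : Fin (rank E) → ℝ, (∀ i, 0 ≤ a i) ∧ x = ∑ i, a i • c i := by
  constructor
  · rintro ⟨y, rfl⟩
    obtain ⟨c, a, hc, rfl⟩ := exists_isJordanFrame_eq_sum y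
    exact ⟨c, hc, fun i => a i * a i, fun i => mul_self_nonneg _,
      hc.isIdemSystem.sum_jmul_sum a a⟩
  · rintro ⟨c, hc, a, ha, rfl⟩
    have hc' : IsJordanFrame c := hc
    refine ⟨∑ i, √(a i) • c i, ?_⟩
    dsimp only
    rw [hc'.isIdemSystem.sum_jmul_sum]
    exact Finset.sum_congr rfl fun i _ => by rw [Real.mul_self_sqrt (ha i)]

end FiniteDimensional

end EuclideanJordanAlgebra

/-! ### Evaluation of tensors at frames -/

section Tensors

variable {V : Type*} [NormedAddCommGroup V] [InnerProductSpace ℝ V] {r m : ℕ}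

theorem tensorInner_tprod_sum (A : ⨂[ℝ]^m V) (c : Fin r → V) (u : Fin r → ℝ) :
    tensorInner V m A (PiTensorProduct.tprod ℝ fun _ => ∑ j, u j • c j)
      = ∑ i : Fin m → Fin r, (∏ k, u (i k)) *
          tensorInner V m A (PiTensorProduct.tprod ℝ fun k => c (i k)) := by
  classical
  rw [MultilinearMap.map_sum (PiTensorProduct.tprod ℝ (s := fun _ : Fin m => V))
    (fun (_ : Fin m) j => u j • c j), map_sum]
  refine Finset.sum_congr rfl fun i _ => ?_
  rw [MultilinearMap.map_smul_univ, map_smul, smul_eq_mul]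

theorem tensorInner_tensorBasis (A : ⨂[ℝ]^m (EuclideanSpace ℝ (Fin r))) (i : Fin m → Fin r) :
    tensorInner _ m A (PiTensorProduct.tprod ℝ fun k => EuclideanSpace.basisFun (Fin r) ℝ (i k))
      = (tensorBasis r m).repr A i := by
  induction A using PiTensorProduct.induction_on with
  | smul_tprod t f =>
    simp only [map_smul, LinearMap.smul_apply, tensorInner_tprod, Finsupp.smul_apply, tensorBasis,
      Basis.piTensorProduct_repr_tprod_apply]
    congr 1
    refine Finset.prod_congr rfl fun k _ => ?_
    rw [OrthonormalBasis.coe_toBasis_repr_apply, OrthonormalBasis.repr_apply_apply,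
      real_inner_comm]
  | add a b ha hb => simp only [map_add, LinearMap.add_apply, Finsupp.add_apply, ha, hb]

theorem tensorInner_symTensor (B : SymTensor (EuclideanSpace ℝ (Fin r)) m)
    (u : EuclideanSpace ℝ (Fin r)) :
    tensorInner _ m B (PiTensorProduct.tprod ℝ fun _ => u)
      = ∑ i : Fin m → Fin r, (∏ k, u (i k)) * symEntry B i := by
  have hu : u = ∑ j, u j • EuclideanSpace.basisFun (Fin r) ℝ j := by
    conv_lhs => rw [← (EuclideanSpace.basisFun (Fin r) ℝ).sum_repr u]
    rfl
  conv_lhs => rw [hu]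
  rw [tensorInner_tprod_sum]
  exact Finset.sum_congr rfl fun i _ => by rw [tensorInner_tensorBasis]; rfl

theorem tensorInner_tensorAt (A : SymTensor V m) (c : Fin r → V) (u : EuclideanSpace ℝ (Fin r)) :
    tensorInner _ m (tensorAt A c) (PiTensorProduct.tprod ℝ fun _ => u)
      = tensorInner V m A (PiTensorProduct.tprod ℝ fun _ => ∑ j, u j • c j) := by
  rw [tensorInner_symTensor, tensorInner_tprod_sum]
  exact Finset.sum_congr rfl fun i _ => by rw [tensorAt, symEntry_ofArray]

theorem symEntry_permIndex (σ : Equiv.Perm (Fin r)) (B : SymTensor (EuclideanSpace ℝ (Fin r)) m)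
    (i : Fin m → Fin r) : symEntry (permIndex σ B) i = symEntry B (σ ∘ i) :=
  symEntry_ofArray _ (fun τ i => symEntry_comp_perm B τ (σ ∘ i)) i

/-- The equivariance by which a permutation-invariant `K` cannot distinguish orderings of one frame.
-/
theorem permIndex_tensorAt (σ : Equiv.Perm (Fin r)) (A : SymTensor V m) (c : Fin r → V) :
    permIndex σ (tensorAt A c) = tensorAt A (c ∘ σ) :=
  symTensor_ext fun i => by
    rw [symEntry_permIndex, tensorAt, tensorAt, symEntry_ofArray, symEntry_ofArray]
    rfl

theorem permIndex_permIndex_symm (σ : Equiv.Perm (Fin r))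
    (B : SymTensor (EuclideanSpace ℝ (Fin r)) m) : permIndex σ (permIndex σ.symm B) = B :=
  symTensor_ext fun i => by
    rw [symEntry_permIndex, symEntry_permIndex, ← Function.comp_assoc, Equiv.symm_comp_self,
      Function.id_comp]

theorem permIndex_mem_copositiveCone (σ : Equiv.Perm (Fin r))
    {B : SymTensor (EuclideanSpace ℝ (Fin r)) m} (hB : B ∈ copositiveCone m (nonnegOrthant r)) :
    permIndex σ B ∈ copositiveCone m (nonnegOrthant r) := by
  intro u hu
  -- Testing `B` at `u ∘ σ⁻¹` and reindexing by `i ↦ σ ∘ i` gives the form of `permIndex σ B` at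
  -- `u`.
  have h := hB (WithLp.toLp 2 fun j => u (σ.symm j)) fun j => hu _
  rw [tensorInner_symTensor] at h ⊢
  refine h.trans_eq (Fintype.sum_equiv (Equiv.arrowCongr (Equiv.refl (Fin m)) σ) _ _
    fun i => ?_).symm
  have hi : Equiv.arrowCongr (Equiv.refl (Fin m)) σ i = σ ∘ i := rfl
  rw [hi, symEntry_permIndex]
  simp

theorem permutationInvariant_copositiveCone :
    PermutationInvariant (copositiveCone m (nonnegOrthant r)) := by
  intro σ
  ext B
  constructor
  · rintro ⟨B, hB, rfl⟩
    exact permIndex_mem_copositiveCone σ hB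
  · intro hB
    exact ⟨_, permIndex_mem_copositiveCone σ.symm hB, permIndex_permIndex_symm σ B⟩

end Tensors

/-! ### Copositive cones as intersections over frames -/

namespace EuclideanJordanAlgebra

variable {E : Type*} [NormedAddCommGroup E] [InnerProductSpace ℝ E] [EuclideanJordanAlgebra E]
  {m : ℕ}

theorem copositiveCone_symmetricCone [FiniteDimensional ℝ E] :
    copositiveCone m (symmetricCone E) = ⋂ c ∈ orderedJordanFrames E,
      {A : SymTensor E m | tensorAt A c ∈ copositiveCone m (nonnegOrthant (rank E))} := by
  ext A
  simp only [Set.mem_iInter, Set.mem_ofPred_eq]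
  constructor
  · intro hA c hc u hu
    rw [tensorInner_tensorAt]
    exact hA _ ((mem_symmetricCone_iff _).2 ⟨c, hc, u, hu, rfl⟩)
  · intro hA x hx
    obtain ⟨c, hc, a, ha, rfl⟩ := (mem_symmetricCone_iff x).1 hx
    have h := hA c hc (WithLp.toLp 2 a) ha
    rwa [tensorInner_tensorAt] at h

/-- Every frame is a reordering of a representative, so the conditions on representatives imply all
others. Comparing each admissible set with the set of all frames settles independence. -/
theorem iInter_admissible_eq {K : Set (SymTensor (EuclideanSpace ℝ (Fin (rank E))) m)}
    (hK : PermutationInvariant K) {𝔉c 𝔉 : Set (Fin (rank E) → E)}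
    (hrep : IsCompleteRepresentatives 𝔉c) (hsub : 𝔉c ⊆ 𝔉) (hframe : 𝔉 ⊆ orderedJordanFrames E) :
    ⋂ c ∈ 𝔉, {A : SymTensor E m | tensorAt A c ∈ K}
      = ⋂ c ∈ orderedJordanFrames E, {A : SymTensor E m | tensorAt A c ∈ K} := by
  refine Set.Subset.antisymm (fun A hA => ?_) (Set.biInter_subset_biInter_left hframe)
  simp only [Set.mem_iInter, Set.mem_ofPred_eq] at hA ⊢
  intro c hc
  obtain ⟨d, ⟨hd, σ, hσ⟩, -⟩ := hrep.2 c hc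
  have hc' : c = d ∘ σ.symm := by
    rw [hσ, Function.comp_assoc, Equiv.self_comp_symm, Function.comp_id]
  rw [hc', ← permIndex_tensorAt, ← hK σ.symm]
  exact Set.mem_image_of_mem _ (hA d (hsub hd))

end EuclideanJordanAlgebra

end

theorem mainTheorem2 (E : Type*) [NormedAddCommGroup E] [InnerProductSpace ℝ E]
    [FiniteDimensional ℝ E] [EuclideanJordanAlgebra E] (m : ℕ) :
    (copositiveCone m (EuclideanJordanAlgebra.symmetricCone E)
      = ⋂ c ∈ EuclideanJordanAlgebra.orderedJordanFrames E,
          {A : SymTensor E m | tensorAt A c ∈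
            copositiveCone m (nonnegOrthant (EuclideanJordanAlgebra.rank E))}) ∧
    (∀ K : Set (SymTensor (EuclideanSpace ℝ (Fin (EuclideanJordanAlgebra.rank E))) m),
      PermutationInvariant K →
      ∀ 𝔉c 𝔉 𝔉c' 𝔉' : Set (Fin (EuclideanJordanAlgebra.rank E) → E),
        EuclideanJordanAlgebra.IsCompleteRepresentatives 𝔉c →
        𝔉c ⊆ 𝔉 → 𝔉 ⊆ EuclideanJordanAlgebra.orderedJordanFrames E →
        EuclideanJordanAlgebra.IsCompleteRepresentatives 𝔉c' →
        𝔉c' ⊆ 𝔉' → 𝔉' ⊆ EuclideanJordanAlgebra.orderedJordanFrames E →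
        (⋂ c ∈ 𝔉, {A : SymTensor E m | tensorAt A c ∈ K})
          = ⋂ c ∈ 𝔉', {A : SymTensor E m | tensorAt A c ∈ K}) ∧
    PermutationInvariant
      (copositiveCone m (nonnegOrthant (EuclideanJordanAlgebra.rank E))) ∧
    (∀ 𝔉c 𝔉 : Set (Fin (EuclideanJordanAlgebra.rank E) → E),
      EuclideanJordanAlgebra.IsCompleteRepresentatives 𝔉c →
      𝔉c ⊆ 𝔉 → 𝔉 ⊆ EuclideanJordanAlgebra.orderedJordanFrames E →
      copositiveCone m (EuclideanJordanAlgebra.symmetricCone E)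
        = ⋂ c ∈ 𝔉, {A : SymTensor E m | tensorAt A c ∈
            copositiveCone m (nonnegOrthant (EuclideanJordanAlgebra.rank E))}) := by
  refine ⟨EuclideanJordanAlgebra.copositiveCone_symmetricCone, ?_,
    permutationInvariant_copositiveCone, ?_⟩
  · intro K hK 𝔉c 𝔉 𝔉c' 𝔉' hrep hsub hframe hrep' hsub' hframe'
    rw [EuclideanJordanAlgebra.iInter_admissible_eq hK hrep hsub hframe,
      EuclideanJordanAlgebra.iInter_admissible_eq hK hrep' hsub' hframe']
  · intro 𝔉c 𝔉 hrep hsub hframe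
    rw [EuclideanJordanAlgebra.iInter_admissible_eq permutationInvariant_copositiveCone
      hrep hsub hframe]
    exact EuclideanJordanAlgebra.copositiveCone_symmetricCone
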